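/- Let $\Phi_F>0$ and let $K\in C^2(\mathbb{R})$ have bounded derivatives $K',K''$ and satisfy $K>0$ on $[0,\Phi_F]$. For $0<T\le+\infty$ and a nondecreasing $Q_{\mathrm{init}}\in C^1([0,1])$ with $Q_{\mathrm{init}}(0)=0$, $Q_{\mathrm{init}}(1)=\Phi_F$ and $Q_{\mathrm{init}}'(1)>K(\Phi_F)$, a classical solution on $[0,T)$ with initial datum $Q_{\mathrm{init}}$ is a pair $(Q,N)$ where $Q\in C^1([0,T)\times[0,1])$ is nondecreasing in $\eta$, $N\in C([0,T))$ is positive, $\partial_\eta Q(\tau,1)>K(\Phi_F)$ for all $\tau\in[0,T)$, and $$\partial_\tau Q+\partial_\eta Q=\frac1{N(\tau)}+K(Q)\quad(0<\tau<T,\ 0<\eta<1),$$ $$Q(\tau,0)=0,\qquad \frac1{N(\tau)}=\partial_\eta Q(\tau,1)-K(\Phi_F)\quad(0<\tau<T),\qquad Q(0,\eta)=Q_{\mathrm{init}}(\eta)\quad(0\le\eta\le1).$$ Set $(x)_-=\min(x,0)$, $(x)_+=\max(x,0)$ and $$k_{\min}=K'(0)+\int_0^{\Phi_F}(K''(\phi))_-\,d\phi,\qquad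 k_{\max}=K'(0)+\int_0^{\Phi_F}(K''(\phi))_+\,d\phi .$$ **Theorem.** Let $(Q_1,N_1)$ and $(Q_2,N_2)$ be classical solutions, for the same $K$ and $\Phi_F$, on $[0,T_1)$ and $[0,T_2)$ respectively, with arbitrary initial data as above. Then $k_{\min}\le k_{\max}$, and for every $\tau\ge0$ with $\tau<T_1$ and $\tau<T_2$ the functions $\partial_\eta Q_1(0,\cdot)-\partial_\eta Q_2(0,\cdot)$ and $\partial_\eta Q_1(\tau,\cdot)-\partial_\eta Q_2(\tau,\cdot)$ are in $L^1(0,1)$ and $$e^{k_{\min}\tau}\,\|\partial_\eta Q_1(0)-\partial_\eta Q_2(0)\|_{L^1(0,1)}\le\|\partial_\eta Q_1(\tau)-\partial_\eta Q_2(\tau)\|_{L^1(0,1)}\le e^{k_{\max}\tau}\,\|\partial_\eta Q_1(0)-\partial_\eta Q_2(0)\|_{L^1(0,1)} .$$ -/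

import Mathlib

noncomputable section

namespace PulseCoupled

/-- The standing assumptions on the phase response function `K` with firing phase `Φ`:
`K` is `C²` on `ℝ`, the derivatives `K'`, `K''` are bounded on `ℝ`, and `K > 0` on `[0, Φ]`. -/
structure IsPhaseResponse (K : ℝ → ℝ) (Φ : ℝ) : Prop where
  contDiff : ContDiff ℝ 2 K
  bounded_deriv : ∃ C : ℝ, ∀ φ : ℝ, |deriv K φ| ≤ C
  bounded_deriv2 : ∃ C : ℝ, ∀ φ : ℝ, |deriv (deriv K) φ| ≤ C
  pos : ∀ φ ∈ Set.Icc (0 : ℝ) Φ, 0 < K φ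

/-- `k_min = K'(0) + ∫₀^Φ (K'')₋`, with `(x)₋ = min(x, 0)`. -/
def kMin (K : ℝ → ℝ) (Φ : ℝ) : ℝ :=
  deriv K 0 + ∫ φ in (0 : ℝ)..Φ, min (deriv (deriv K) φ) 0

/-- `k_max = K'(0) + ∫₀^Φ (K'')₊`, with `(x)₊ = max(x, 0)`. -/
def kMax (K : ℝ → ℝ) (Φ : ℝ) : ℝ :=
  deriv K 0 + ∫ φ in (0 : ℝ)..Φ, max (deriv (deriv K) φ) 0

/-- The time interval `[0, T)`, where `T` may be `+∞`. -/
def timeInterval (T : EReal) : Set ℝ := {τ : ℝ | 0 ≤ τ ∧ (τ : EReal) < T}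

/-- The derivative of a profile `q` on `[0, 1]`; it is one-sided at the end points. -/
def dEta (q : ℝ → ℝ) (η : ℝ) : ℝ := derivWithin q (Set.Icc (0 : ℝ) 1) η

/-- Admissible initial data: a nondecreasing `C¹` function on `[0, 1]` with `q 0 = 0`,
`q 1 = Φ` and `q'(1) > K Φ`. -/
structure IsInitialDatum (K : ℝ → ℝ) (Φ : ℝ) (q : ℝ → ℝ) : Prop where
  contDiffOn : ContDiffOn ℝ 1 q (Set.Icc (0 : ℝ) 1)
  monotoneOn : MonotoneOn q (Set.Icc (0 : ℝ) 1)
  at_zero : q 0 = 0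
  at_one : q 1 = Φ
  deriv_one : K Φ < dEta q 1

/-- `(Q, N)` is a classical solution on `[0, T)`, `0 < T ≤ +∞`, with initial datum `Qinit`, of
`∂_τ Q + ∂_η Q = 1 / N(τ) + K(Q)`, `Q(τ, 0) = 0`, `1 / N(τ) = ∂_η Q(τ, 1) - K(Φ)`. Only the values
of `Q` on `[0, T) × [0, 1]` and of `N` on `[0, T)` matter. -/
structure IsClassicalSolution (K : ℝ → ℝ) (Φ : ℝ) (Qinit : ℝ → ℝ) (T : EReal)
    (Q : ℝ → ℝ → ℝ) (N : ℝ → ℝ) : Prop where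
  T_pos : 0 < T
  init_datum : IsInitialDatum K Φ Qinit
  contDiffOn : ContDiffOn ℝ 1 (fun p : ℝ × ℝ => Q p.1 p.2)
    (timeInterval T ×ˢ Set.Icc (0 : ℝ) 1)
  monotoneOn : ∀ τ ∈ timeInterval T, MonotoneOn (Q τ) (Set.Icc (0 : ℝ) 1)
  continuousOn_N : ContinuousOn N (timeInterval T)
  N_pos : ∀ τ ∈ timeInterval T, 0 < N τ
  equation : ∀ τ ∈ timeInterval T, 0 < τ → ∀ η ∈ Set.Ioo (0 : ℝ) 1,
    deriv (fun s => Q s η) τ + dEta (Q τ) η = 1 / N τ + K (Q τ η)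
  boundary : ∀ τ ∈ timeInterval T, 0 < τ → Q τ 0 = 0
  firing_rate : ∀ τ ∈ timeInterval T, 0 < τ → 1 / N τ = dEta (Q τ) 1 - K Φ
  initial : ∀ η ∈ Set.Icc (0 : ℝ) 1, Q 0 η = Qinit η
  constraint : ∀ τ ∈ timeInterval T, K Φ < dEta (Q τ) 1

/-- The distance `‖∂_η q₁ - ∂_η q₂‖_{L¹(0,1)}` of two profiles. -/
def distBV (q₁ q₂ : ℝ → ℝ) : ℝ :=
  ∫ η in Set.Ioo (0 : ℝ) 1, |dEta q₁ η - dEta q₂ η|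

end PulseCoupled

end

open Set Filter Topology MeasureTheory

/-! Write `p = ∂_η Q`. Differentiating the equation in `η` removes the nonlocal term `1 / N(τ)` and
leaves `∂_τ p + ∂_η p = K'(Q) p`. At `η = 0` the equation reads `p(τ, 0) = 1 / N + K(0)`, so the
firing condition becomes `p(τ, 0) - p(τ, 1) = K(0) - K(Φ)`. The difference `d = p₁ - p₂` is
therefore periodic in `η`: transport preserves its `L¹` norm, and the norm changes only at the rate
`∫ sgn(d) (K'(Q₁) p₁ - K'(Q₂) p₂)` (`transport_deriv`, `l1_growth`).

To bound this rate, write `K'(u) = K'(0) + ∫₀^Φ K''(ψ) 1_{ψ < u} dψ` (`comp_eq_integral_levels`).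
The rate becomes `K'(0) ‖d‖ + ∫₀^Φ K''(ψ) J(ψ) dψ` with `J(ψ) = ∫ sgn(d) (1_{Q₁ > ψ} p₁ - 1_{Q₂ > ψ}
p₂)`. The heart of the proof is `0 ≤ J(ψ) ≤ ‖d‖` (`level_bounds`), which holds because both profiles
are nondecreasing from `0` to `Φ`. Hence the rate lies between `k_min ‖d‖` and `k_max ‖d‖`, and
Grönwall's inequality concludes. The lower bound is the upper one after reversing time and phase and
replacing `K'` by `-K'`.

As `p` is merely continuous, its equation is used only in integrated form along characteristics
(`IsMildSolution`). -/

namespace PulseCoupled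

/-! ### Growth of the `L¹` norm under periodic transport with a source -/

/-- A measurable selection of the subdifferential of the absolute value. -/
noncomputable def sgn (x : ℝ) : ℝ := if 0 ≤ x then 1 else -1

lemma measurable_sgn : Measurable sgn :=
  Measurable.ite measurableSet_Ici measurable_const measurable_const

lemma abs_sgn (x : ℝ) : |sgn x| = 1 := by
  unfold sgn; split_ifs <;> simp

lemma sgn_mul_self (x : ℝ) : sgn x * x = |x| := by
  unfold sgn
  split_ifs with h
  · rw [abs_of_nonneg h, one_mul]
  · rw [abs_of_neg (not_le.1 h)]; ring

lemma sgn_mul_le_abs (x y : ℝ) : sgn x * y ≤ |y| := by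
  calc sgn x * y ≤ |sgn x * y| := le_abs_self _
    _ = |y| := by rw [abs_mul, abs_sgn, one_mul]

/-- Convexity of `|·|`, with the subgradient taken at `x`. In `l1_step`, `x` is the value at the
later time, so the sign appears at one time only and no continuity of `sgn` is needed. -/
lemma abs_le_abs_add_sgn_mul (x y : ℝ) : |x| ≤ |y| + sgn x * (x - y) := by
  rw [mul_sub, sgn_mul_self]
  linarith [sgn_mul_le_abs x y]

lemma intervalIntegrable_mul_of_bdd {s f : ℝ → ℝ} (hs : Measurable s) (hb : ∀ x, |s x| ≤ 1)
    {a b : ℝ} (hf : IntervalIntegrable f volume a b) :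
    IntervalIntegrable (fun x => s x * f x) volume a b := by
  rw [intervalIntegrable_iff] at hf ⊢
  exact Integrable.bdd_mul hf hs.aestronglyMeasurable (Eventually.of_forall hb)

/-- One step of the `L¹` estimate for a function transported along the characteristics. -/
lemma l1_step {d r : ℝ → ℝ → ℝ} {x h ε M : ℝ} (hd : Continuous (Function.uncurry d))
    (hr : Continuous (Function.uncurry r)) (hh : 0 ≤ h) (hh1 : h ≤ 1)
    (htr : ∀ y, 0 ≤ y → y + h ≤ 1 →
      d (x + h) (y + h) = d x y + ∫ s in (0 : ℝ)..h, r (x + s) (y + s))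
    (hbd : d x 0 = d x 1)
    (hr_osc : ∀ y, 0 ≤ y → y + h ≤ 1 → ∀ s, 0 ≤ s → s ≤ h →
      |r (x + s) (y + s) - r (x + h) (y + h)| ≤ ε)
    (hd0 : ∀ y, 0 ≤ y → y ≤ h → |d (x + h) y - d x 0| ≤ ε)
    (hd1 : ∀ y, 1 - h ≤ y → y ≤ 1 → |d x y - d x 1| ≤ ε)
    (hM : ∀ y, 0 ≤ y → y ≤ 1 → |r (x + h) y| ≤ M) (hε : 0 ≤ ε) :
    (∫ y in (0 : ℝ)..1, |d (x + h) y|) - ∫ y in (0 : ℝ)..1, |d x y| ≤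
      h * ((∫ y in (0 : ℝ)..1, sgn (d (x + h) y) * r (x + h) y) + h * M + 3 * ε) := by
  have cd : ∀ t, Continuous (d t) := fun t => hd.comp (Continuous.prodMk_right t)
  have cr : ∀ t, Continuous (r t) := fun t => hr.comp (Continuous.prodMk_right t)
  have id : ∀ t a b, IntervalIntegrable (fun y => |d t y|) volume a b := fun t a b =>
    (cd t).abs.intervalIntegrable a b
  have isr : ∀ a b, IntervalIntegrable (fun y => sgn (d (x + h) y) * r (x + h) y) volume a b :=
    fun a b => intervalIntegrable_mul_of_bdd (measurable_sgn.comp (cd _).measurable)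
      (fun _ => (abs_sgn _).le) ((cr _).intervalIntegrable a b)
  -- Convexity along each characteristic that stays in `[0, 1]`, with the source frozen at the final
  -- point at a cost of `ε * h`.
  have pt : ∀ y ∈ Icc 0 (1 - h), |d (x + h) (y + h)| ≤
      |d x y| + h * (sgn (d (x + h) (y + h)) * r (x + h) (y + h)) + ε * h := by
    intro y hy
    have hy1 : y + h ≤ 1 := by linarith [hy.2]
    have c1 : Continuous fun s => r (x + s) (y + s) :=
      hr.comp ((continuous_const.add continuous_id).prodMk (continuous_const.add continuous_id))
    have h1 : ‖∫ s in (0 : ℝ)..h, (r (x + s) (y + s) - r (x + h) (y + h))‖ ≤ ε * |h - 0| := by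
      refine intervalIntegral.norm_integral_le_of_norm_le_const fun s hs => ?_
      rw [uIoc_of_le hh] at hs
      exact hr_osc y hy.1 hy1 s hs.1.le hs.2
    rw [intervalIntegral.integral_sub (c1.intervalIntegrable _ _) (by simp),
      intervalIntegral.integral_const, sub_zero, abs_of_nonneg hh, Real.norm_eq_abs,
      smul_eq_mul] at h1
    have h2 := abs_le_abs_add_sgn_mul (d (x + h) (y + h)) (d x y)
    have h3 : d (x + h) (y + h) - d x y =
      h * r (x + h) (y + h) + ((∫ s in (0 : ℝ)..h, r (x + s) (y + s)) - h * r (x + h) (y + h)) := by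
      rw [htr y hy.1 hy1]; ring
    rw [h3, mul_add] at h2
    have h4 := sgn_mul_le_abs (d (x + h) (y + h))
      ((∫ s in (0 : ℝ)..h, r (x + s) (y + s)) - h * r (x + h) (y + h))
    have h5 : sgn (d (x + h) (y + h)) * (h * r (x + h) (y + h)) =
      h * (sgn (d (x + h) (y + h)) * r (x + h) (y + h)) := by ring
    linarith
  have hmain : (∫ y in h..1, |d (x + h) y|) ≤ (∫ y in (0 : ℝ)..(1 - h), |d x y|) +
      h * (∫ y in h..1, sgn (d (x + h) y) * r (x + h) y) + ε * h := by
    have e1 := intervalIntegral.integral_comp_add_right (a := 0) (b := 1 - h)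
      (fun y => |d (x + h) y|) h
    have e2 := intervalIntegral.integral_comp_add_right (a := 0) (b := 1 - h)
      (fun y => sgn (d (x + h) y) * r (x + h) y) h
    rw [zero_add, sub_add_cancel] at e1 e2
    rw [← e1, ← e2]
    have i2 : IntervalIntegrable
        (fun y => sgn (d (x + h) (y + h)) * r (x + h) (y + h)) volume 0 (1 - h) := by
      simpa using (isr h 1).comp_add_right h
    have i1 : IntervalIntegrable (fun y => |d (x + h) (y + h)|) volume 0 (1 - h) := by
      simpa using (id (x + h) h 1).comp_add_right h
    have := intervalIntegral.integral_mono_on (by linarith) i1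
      (((id x 0 (1 - h)).add (i2.const_mul h)).add
        (intervalIntegrable_const (c := ε * h))) pt
    rw [intervalIntegral.integral_add ((id x 0 (1 - h)).add (i2.const_mul h))
      (by simp), intervalIntegral.integral_add (id x 0 (1 - h)) (i2.const_mul h),
      intervalIntegral.integral_const_mul, intervalIntegral.integral_const, smul_eq_mul,
      sub_zero] at this
    nlinarith [mul_nonneg (mul_nonneg hε hh) hh]
  -- The mass entering through `0` is at most about `h * |d x 0|`, the mass leaving through `1` is
  -- at least about `h * |d x 1|`. They cancel by periodicity, each with an error `ε * h`.
  have hA : (∫ y in (0 : ℝ)..h, |d (x + h) y|) ≤ h * (|d x 0| + ε) := by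
    have := intervalIntegral.integral_mono_on hh (id (x + h) 0 h)
      (intervalIntegrable_const (c := |d x 0| + ε)) (fun y hy => by
        have := hd0 y hy.1 hy.2
        have h2 := abs_sub_abs_le_abs_sub (d (x + h) y) (d x 0)
        linarith)
    simpa [mul_add] using this
  have hB : h * (|d x 1| - ε) ≤ ∫ y in (1 - h)..1, |d x y| := by
    have := intervalIntegral.integral_mono_on (by linarith)
      (intervalIntegrable_const (c := |d x 1| - ε)) (id x (1 - h) 1) (fun y hy => by
        have := hd1 y hy.1 hy.2
        have h2 := abs_sub_abs_le_abs_sub (d x 1) (d x y)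
        rw [abs_sub_comm] at h2
        linarith)
    simpa [mul_sub] using this
  -- Allows the production integral over `[h, 1]` to be replaced by the one over `[0, 1]`; this is
  -- the term `h * M` of the conclusion.
  have hC : -(M * h) ≤ ∫ y in (0 : ℝ)..h, sgn (d (x + h) y) * r (x + h) y := by
    have := intervalIntegral.norm_integral_le_of_norm_le_const (a := 0) (b := h) (C := M)
      (f := fun y => sgn (d (x + h) y) * r (x + h) y) (fun y hy => by
        rw [uIoc_of_le hh] at hy
        rw [Real.norm_eq_abs, abs_mul, abs_sgn, one_mul]
        exact hM y hy.1.le (hy.2.trans hh1))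
    rw [sub_zero, abs_of_nonneg hh, Real.norm_eq_abs] at this
    exact (abs_le.1 this).1
  rw [← intervalIntegral.integral_add_adjacent_intervals (id (x + h) 0 h) (id (x + h) h 1),
    ← intervalIntegral.integral_add_adjacent_intervals (id x 0 (1 - h)) (id x (1 - h) 1),
    ← intervalIntegral.integral_add_adjacent_intervals (isr 0 h) (isr h 1)]
  rw [hbd] at hA
  nlinarith [mul_le_mul_of_nonneg_left hC hh]

/-- Growth of the `L¹` norm of a function transported along the characteristics, with source `r`
and periodic boundary values. -/
theorem l1_growth {d r : ℝ → ℝ → ℝ} {b C : ℝ} (hb : 0 ≤ b)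
    (hd : Continuous (Function.uncurry d)) (hr : Continuous (Function.uncurry r))
    (htr : ∀ x h y, 0 ≤ x → 0 ≤ h → h < 1 → x + h ≤ b → 0 ≤ y → y + h ≤ 1 →
      d (x + h) (y + h) = d x y + ∫ s in (0 : ℝ)..h, r (x + s) (y + s))
    (hbd : ∀ x ∈ Icc 0 b, d x 0 = d x 1)
    (hrate : ∀ x ∈ Icc 0 b, (∫ y in (0 : ℝ)..1, sgn (d x y) * r x y) ≤
      C * ∫ y in (0 : ℝ)..1, |d x y|) :
    (∫ y in (0 : ℝ)..1, |d b y|) ≤ Real.exp (C * b) * ∫ y in (0 : ℝ)..1, |d 0 y| := by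
  set n : ℝ → ℝ := fun t => ∫ y in (0 : ℝ)..1, |d t y| with hn
  have cn : Continuous n :=
    intervalIntegral.continuous_parametric_intervalIntegral_of_continuous' (by fun_prop) 0 1
  have key := le_gronwallBound_of_liminf_deriv_right_le (f := n) (f' := fun t => C * n t)
    (δ := n 0) (K := C) (ε := 0) (a := 0) (b := b) cn.continuousOn ?_ le_rfl (by simp) b
    ⟨hb, le_rfl⟩
  · rw [gronwallBound_ε0, sub_zero] at key
    linarith
  intro x hx ρ hρ
  refine Eventually.frequently ?_
  -- The five `ε`: three from `l1_step`, one for `h * M ≤ ε`, one for replacing `C * n (x + h)` by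
  -- `C * n x`.
  obtain ⟨ε, hε, hερ⟩ : ∃ ε > 0, C * n x + 5 * ε < ρ :=
    ⟨(ρ - C * n x) / 6, by linarith, by linarith⟩
  have hK : IsCompact (Icc (0 : ℝ) b ×ˢ Icc (0 : ℝ) 1) := isCompact_Icc.prod isCompact_Icc
  obtain ⟨M, hM⟩ := hK.exists_bound_of_continuousOn hr.continuousOn
  have hMnn : 0 ≤ M := (norm_nonneg _).trans (hM (x, 0) ⟨⟨hx.1, hx.2.le⟩, by simp⟩)
  obtain ⟨δ₁, hδ₁, hd'⟩ := Metric.uniformContinuousOn_iff.1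
    (hK.uniformContinuousOn_of_continuous hd.continuousOn) ε hε
  obtain ⟨δ₂, hδ₂, hr'⟩ := Metric.uniformContinuousOn_iff.1
    (hK.uniformContinuousOn_of_continuous hr.continuousOn) ε hε
  have ev1 : ∀ᶠ z in 𝓝[>] x, C * n z < C * n x + ε :=
    nhdsWithin_le_nhds ((continuous_const.mul cn).continuousAt.eventually_lt
      continuousAt_const (by simp only [Pi.mul_apply]; linarith))
  have ev2 : ∀ᶠ z in 𝓝[>] x, z < x + min (min δ₁ δ₂) (min 1 (min (b - x) (ε / (M + 1)))) :=
    nhdsWithin_le_nhds (eventually_lt_nhds (by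
      have : 0 < b - x := by linarith [hx.2]
      have : 0 < min (min δ₁ δ₂) (min 1 (min (b - x) (ε / (M + 1)))) := by positivity
      linarith))
  filter_upwards [ev1, ev2, self_mem_nhdsWithin] with z hz1 hz2 hz3
  obtain ⟨h, rfl⟩ : ∃ h, z = x + h := ⟨z - x, by ring⟩
  rw [mem_Ioi, lt_add_iff_pos_right] at hz3
  rw [add_lt_add_iff_left] at hz2
  simp only [lt_min_iff] at hz2
  obtain ⟨⟨a1, a2⟩, a3, a4, a5⟩ := hz2
  have hxb : x + h ≤ b := by linarith
  have a6 : h * M ≤ ε := by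
    rw [lt_div_iff₀ (by linarith)] at a5
    linarith
  have hx0 := hx.1
  have step := l1_step (x := x) (h := h) (ε := ε) (M := M) hd hr hz3.le a3.le
    (fun y hy hy1 => htr x h y hx.1 hz3.le a3 hxb hy hy1) (hbd x ⟨hx.1, hx.2.le⟩)
    (fun y hy hy1 s hs hs1 => by
      refine (hr' (x + s, y + s) ⟨⟨by simp only; linarith, by simp only; linarith⟩,
        by simp only; linarith, by simp only; linarith⟩ (x + h, y + h)
        ⟨⟨by simp only; linarith, by simp only; linarith⟩,
        by simp only; linarith, by simp only; linarith⟩ ?_).le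
      rw [Prod.dist_eq, max_lt_iff, Real.dist_eq, Real.dist_eq, abs_lt, abs_lt]
      simp only
      exact ⟨⟨by linarith, by linarith⟩, by linarith, by linarith⟩)
    (fun y hy hy1 => by
      refine (hd' (x + h, y) ⟨⟨by simp only; linarith, by simp only; linarith⟩,
        by simp only; linarith, by simp only; linarith⟩ (x, 0)
        ⟨⟨by simp only; linarith, by simp only; linarith⟩, by simp⟩ ?_).le
      rw [Prod.dist_eq, max_lt_iff, Real.dist_eq, Real.dist_eq, abs_lt, abs_lt]
      simp only
      exact ⟨⟨by linarith, by linarith⟩, by linarith, by linarith⟩)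
    (fun y hy hy1 => by
      refine (hd' (x, y) ⟨⟨by simp only; linarith, by simp only; linarith⟩,
        by simp only; linarith, by simp only; linarith⟩ (x, 1)
        ⟨⟨by simp only; linarith, by simp only; linarith⟩, by simp⟩ ?_).le
      rw [Prod.dist_eq, max_lt_iff, Real.dist_eq, Real.dist_eq, abs_lt, abs_lt]
      simp only
      exact ⟨⟨by linarith, by linarith⟩, by linarith, by linarith⟩)
    (fun y hy hy1 => hM (x + h, y) ⟨⟨by simp only; linarith, hxb⟩, hy, hy1⟩) hε.le
  have rate := hrate (x + h) ⟨by linarith, hxb⟩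
  change n (x + h) - n x ≤ _ at step
  change _ ≤ C * n (x + h) at rate
  rw [add_sub_cancel_left, inv_mul_lt_iff₀ hz3]
  refine step.trans_lt (mul_lt_mul_of_pos_left ?_ hz3)
  linarith

/-- Lower bound for the growth of the `L¹` norm, by reversal of both variables. -/
theorem l1_growth_lower {d r : ℝ → ℝ → ℝ} {b c : ℝ} (hb : 0 ≤ b)
    (hd : Continuous (Function.uncurry d)) (hr : Continuous (Function.uncurry r))
    (htr : ∀ x h y, 0 ≤ x → 0 ≤ h → h < 1 → x + h ≤ b → 0 ≤ y → y + h ≤ 1 →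
      d (x + h) (y + h) = d x y + ∫ s in (0 : ℝ)..h, r (x + s) (y + s))
    (hbd : ∀ x ∈ Icc 0 b, d x 0 = d x 1)
    (hrate : ∀ x ∈ Icc 0 b, c * (∫ y in (0 : ℝ)..1, |d x y|) ≤
      ∫ y in (0 : ℝ)..1, sgn (d x y) * r x y) :
    Real.exp (c * b) * (∫ y in (0 : ℝ)..1, |d 0 y|) ≤ ∫ y in (0 : ℝ)..1, |d b y| := by
  have cm : Continuous fun z : ℝ × ℝ => (b - z.1, 1 - z.2) := by fun_prop
  have flip : ∀ g : ℝ → ℝ, ∫ y in (0 : ℝ)..1, g (1 - y) = ∫ y in (0 : ℝ)..1, g y := by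
    intro g
    rw [intervalIntegral.integral_comp_sub_left]
    simp
  -- Reversing both variables maps characteristics to characteristics run backwards, so the source
  -- changes sign and periodicity survives.
  have key := l1_growth (d := fun t y => d (b - t) (1 - y)) (r := fun t y => -r (b - t) (1 - y))
    (b := b) (C := -c) hb (hd.comp cm) (hr.comp cm).neg ?_ ?_ ?_
  · simp only [sub_self, sub_zero] at key
    rw [flip fun y => |d 0 y|, flip fun y => |d b y|] at key
    calc _ ≤ Real.exp (c * b) * (Real.exp (-c * b) * ∫ y in (0 : ℝ)..1, |d b y|) :=
        mul_le_mul_of_nonneg_left key (Real.exp_pos _).le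
      _ = _ := by rw [← mul_assoc, ← Real.exp_add]; simp
  · intro x h y hx hh hh1 hxb hy hy1
    have := htr (b - (x + h)) h (1 - (y + h)) (by linarith) hh hh1 (by linarith) (by linarith)
      (by linarith)
    have e := intervalIntegral.integral_comp_sub_left (a := 0) (b := h)
      (fun s => r (b - (x + h) + s) (1 - (y + h) + s)) h
    rw [sub_self, sub_zero] at e
    rw [← e] at this
    have e2 : ∀ s, r (b - (x + h) + (h - s)) (1 - (y + h) + (h - s)) =
        r (b - (x + s)) (1 - (y + s)) := fun s => by congr 1 <;> ring
    simp only [e2] at this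
    rw [show b - (x + h) + h = b - x by ring, show 1 - (y + h) + h = 1 - y by ring] at this
    simp only [intervalIntegral.integral_neg]
    linarith
  · intro x hx
    simpa using (hbd (b - x) ⟨by linarith [hx.2], by linarith [hx.1]⟩).symm
  · intro x hx
    have := hrate (b - x) ⟨by linarith [hx.2], by linarith [hx.1]⟩
    rw [flip fun y => |d (b - x) y|, flip fun y => sgn (d (b - x) y) * -r (b - x) y]
    simp only [mul_neg, intervalIntegral.integral_neg]
    linarith

end PulseCoupled

/-! ### The production term, level by level -/

namespace PulseCoupled

/-- The superlevel sets of a monotone continuous function on `[0, 1]`. -/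
lemma exists_level {q : ℝ → ℝ} (hq : Continuous q) (hm : MonotoneOn q (Icc 0 1)) {ψ : ℝ}
    (h0 : q 0 ≤ ψ) (h1 : ψ < q 1) :
    ∃ η ∈ Icc (0 : ℝ) 1, q η = ψ ∧ ∀ y ∈ Icc (0 : ℝ) 1, ψ < q y ↔ η < y := by
  have hc : IsCompact (Icc (0 : ℝ) 1 ∩ q ⁻¹' {ψ}) :=
    isCompact_Icc.inter_right (isClosed_singleton.preimage hq)
  have hne : (Icc (0 : ℝ) 1 ∩ q ⁻¹' {ψ}).Nonempty := by
    obtain ⟨y, hy, e⟩ := intermediate_value_Icc zero_le_one hq.continuousOn ⟨h0, h1.le⟩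
    exact ⟨y, hy, e⟩
  -- `q` may be flat at height `ψ`; the last point of the level set makes the superlevel set exactly
  -- `(η, 1]`.
  obtain ⟨η, ⟨hη, he⟩, hmax⟩ := hc.exists_isGreatest hne
  refine ⟨η, hη, he, fun y hy => ⟨fun h => ?_, fun h => ?_⟩⟩
  · by_contra! hle
    have := hm hy hη hle
    rw [mem_preimage, mem_singleton_iff] at he
    linarith
  · have h2 := hm hη hy h.le
    rw [mem_preimage, mem_singleton_iff] at he
    rw [he] at h2
    refine h2.lt_of_ne fun h3 => ?_
    exact absurd (hmax ⟨hy, h3.symm⟩) (not_le.2 h)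

lemma integral_congr_of_eqOn_uIoc {f g : ℝ → ℝ} {a b : ℝ} (h : EqOn f g (uIoc a b)) :
    ∫ x in a..b, f x = ∫ x in a..b, g x :=
  intervalIntegral.integral_congr_ae (Eventually.of_forall h)

/-- The part of `f` over the superlevel set `{ψ < q}`. -/
noncomputable def above (q f : ℝ → ℝ) (ψ y : ℝ) : ℝ := if ψ < q y then f y else 0

/-- The contribution of one level `ψ`, with the levels of the two profiles ordered. -/
lemma level_bounds_aux {p₁ p₂ q₁ q₂ s : ℝ → ℝ} {Φ ψ η₁ η₂ : ℝ}
    (cp₁ : Continuous p₁) (cp₂ : Continuous p₂)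
    (hp₁ : ∀ y, 0 ≤ p₁ y) (hp₂ : ∀ y, 0 ≤ p₂ y)
    (hq₁ : ∀ x y, x ∈ Icc (0 : ℝ) 1 → y ∈ Icc (0 : ℝ) 1 → ∫ z in x..y, p₁ z = q₁ y - q₁ x)
    (hq₂ : ∀ x y, x ∈ Icc (0 : ℝ) 1 → y ∈ Icc (0 : ℝ) 1 → ∫ z in x..y, p₂ z = q₂ y - q₂ x)
    (hq₁0 : q₁ 0 = 0) (hq₂0 : q₂ 0 = 0) (hq₁1 : q₁ 1 = Φ) (hq₂1 : q₂ 1 = Φ)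
    (hs : Measurable s) (hs1 : ∀ y, |s y| ≤ 1) (hsd : ∀ y, s y * (p₁ y - p₂ y) = |p₁ y - p₂ y|)
    (h₁ : η₁ ∈ Icc (0 : ℝ) 1) (h₂ : η₂ ∈ Icc (0 : ℝ) 1) (e₁ : q₁ η₁ = ψ) (e₂ : q₂ η₂ = ψ)
    (l₁ : ∀ y ∈ Icc (0 : ℝ) 1, ψ < q₁ y ↔ η₁ < y) (l₂ : ∀ y ∈ Icc (0 : ℝ) 1, ψ < q₂ y ↔ η₂ < y)
    (hle : η₁ ≤ η₂) :
    (0 ≤ ∫ y in (0 : ℝ)..1, s y * (above q₁ p₁ ψ y - above q₂ p₂ ψ y)) ∧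
      (∫ y in (0 : ℝ)..1, s y * (above q₁ p₁ ψ y - above q₂ p₂ ψ y)) ≤
        ∫ y in (0 : ℝ)..1, |p₁ y - p₂ y| := by
  set f : ℝ → ℝ := fun y => s y * (above q₁ p₁ ψ y - above q₂ p₂ ψ y) with hf
  have i₁ : ∀ a b, IntervalIntegrable p₁ volume a b := cp₁.intervalIntegrable
  have i₂ : ∀ a b, IntervalIntegrable p₂ volume a b := cp₂.intervalIntegrable
  have ia : ∀ a b, IntervalIntegrable (fun y => |p₁ y - p₂ y|) volume a b :=
    (cp₁.sub cp₂).abs.intervalIntegrable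
  have is₁ : ∀ a b, IntervalIntegrable (fun y => s y * p₁ y) volume a b :=
    fun a b => intervalIntegrable_mul_of_bdd hs hs1 (i₁ a b)
  have f₀ : EqOn (fun _ => (0 : ℝ)) f (uIoc 0 η₁) := by
    intro y hy
    rw [uIoc_of_le h₁.1] at hy
    have hy' : y ∈ Icc (0 : ℝ) 1 := ⟨hy.1.le, hy.2.trans h₁.2⟩
    simp [hf, above, l₁ y hy', l₂ y hy', not_lt.2 hy.2, not_lt.2 (hy.2.trans hle)]
  have f₁ : EqOn (fun y => s y * p₁ y) f (uIoc η₁ η₂) := by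
    intro y hy
    rw [uIoc_of_le hle] at hy
    have hy' : y ∈ Icc (0 : ℝ) 1 := ⟨h₁.1.trans hy.1.le, hy.2.trans h₂.2⟩
    simp [hf, above, l₁ y hy', l₂ y hy', hy.1, not_lt.2 hy.2]
  have f₂ : EqOn (fun y => |p₁ y - p₂ y|) f (uIoc η₂ 1) := by
    intro y hy
    rw [uIoc_of_le h₂.2] at hy
    have hy' : y ∈ Icc (0 : ℝ) 1 := ⟨h₂.1.trans hy.1.le, hy.2⟩
    simp [hf, above, l₁ y hy', l₂ y hy', hy.1, hle.trans_lt hy.1, hsd]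
  have if₀ : IntervalIntegrable f volume 0 η₁ :=
    (intervalIntegrable_const (c := (0 : ℝ))).congr f₀
  have if₁ : IntervalIntegrable f volume η₁ η₂ := (is₁ _ _).congr f₁
  have if₂ : IntervalIntegrable f volume η₂ 1 := (ia _ _).congr f₂
  have eJ : ∫ y in (0 : ℝ)..1, f y =
      (∫ y in η₁..η₂, s y * p₁ y) + ∫ y in η₂..1, |p₁ y - p₂ y| := by
    rw [← intervalIntegral.integral_add_adjacent_intervals if₀ (if₁.trans if₂),
      ← intervalIntegral.integral_add_adjacent_intervals if₁ if₂,
      ← integral_congr_of_eqOn_uIoc f₀, ← integral_congr_of_eqOn_uIoc f₁,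
      ← integral_congr_of_eqOn_uIoc f₂]
    simp
  have eD : ∫ y in (0 : ℝ)..1, |p₁ y - p₂ y| = (∫ y in (0 : ℝ)..η₁, |p₁ y - p₂ y|) +
      (∫ y in η₁..η₂, |p₁ y - p₂ y|) + ∫ y in η₂..1, |p₁ y - p₂ y| := by
    rw [intervalIntegral.integral_add_adjacent_intervals (ia _ _) (ia _ _),
      intervalIntegral.integral_add_adjacent_intervals (ia _ _) (ia _ _)]
  have sb : ∀ y, -1 ≤ s y ∧ s y ≤ 1 := fun y => abs_le.1 (hs1 y)
  have m0 : (0 : ℝ) ∈ Icc (0 : ℝ) 1 := by simp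
  have m1 : (1 : ℝ) ∈ Icc (0 : ℝ) 1 := by simp
  constructor
  · rw [eJ]
    -- The strip `[η₁, η₂]` contributes at least `-(q₁ η₂ - ψ)`. On `[η₂, 1]` the profile `q₂` rises
    -- by `Φ - ψ` and `q₁` only by `Φ - q₁ η₂`, so `|p₁ - p₂|` has integral at least `q₁ η₂ - ψ`
    -- there.
    have b1 : -(∫ y in η₁..η₂, p₁ y) ≤ ∫ y in η₁..η₂, s y * p₁ y := by
      rw [← intervalIntegral.integral_neg]
      refine intervalIntegral.integral_mono_on hle (i₁ _ _).neg (is₁ _ _) fun y _ => ?_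
      nlinarith [hp₁ y, (sb y).1]
    have b2 : (∫ y in η₂..1, (p₂ y - p₁ y)) ≤ ∫ y in η₂..1, |p₁ y - p₂ y| :=
      intervalIntegral.integral_mono_on h₂.2 ((i₂ _ _).sub (i₁ _ _)) (ia _ _) fun y _ => by
        rw [abs_sub_comm]; exact le_abs_self _
    rw [intervalIntegral.integral_sub (i₂ _ _) (i₁ _ _), hq₂ _ _ h₂ m1, hq₁ _ _ h₂ m1] at b2
    rw [hq₁ _ _ h₁ h₂] at b1
    linarith
  · rw [eJ, eD]
    -- The excess `∫ p₂` over the strip is `ψ - q₂ η₁ = q₁ η₁ - q₂ η₁`, which is at most the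
    -- integral of `|p₁ - p₂|` over `[0, η₁]`.
    have b1 : (∫ y in η₁..η₂, s y * p₁ y) ≤
        ∫ y in η₁..η₂, (|p₁ y - p₂ y| + p₂ y) := by
      refine intervalIntegral.integral_mono_on hle (is₁ _ _) ((ia _ _).add (i₂ _ _)) fun y _ => ?_
      rw [← hsd]
      nlinarith [hp₂ y, (sb y).2]
    have b2 : (∫ y in (0 : ℝ)..η₁, (p₁ y - p₂ y)) ≤ ∫ y in (0 : ℝ)..η₁, |p₁ y - p₂ y| :=
      intervalIntegral.integral_mono_on h₁.1 ((i₁ _ _).sub (i₂ _ _)) (ia _ _) fun y _ =>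
        le_abs_self _
    rw [intervalIntegral.integral_sub (i₁ _ _) (i₂ _ _), hq₁ _ _ m0 h₁, hq₂ _ _ m0 h₁] at b2
    rw [intervalIntegral.integral_add (ia _ _) (i₂ _ _), hq₂ _ _ h₁ h₂] at b1
    linarith

/-- The contribution of one level `ψ ∈ [0, Φ)`. -/
lemma level_bounds {p₁ p₂ q₁ q₂ s : ℝ → ℝ} {Φ ψ : ℝ}
    (cp₁ : Continuous p₁) (cp₂ : Continuous p₂) (cq₁ : Continuous q₁) (cq₂ : Continuous q₂)
    (hp₁ : ∀ y, 0 ≤ p₁ y) (hp₂ : ∀ y, 0 ≤ p₂ y)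
    (hq₁ : ∀ x y, x ∈ Icc (0 : ℝ) 1 → y ∈ Icc (0 : ℝ) 1 → ∫ z in x..y, p₁ z = q₁ y - q₁ x)
    (hq₂ : ∀ x y, x ∈ Icc (0 : ℝ) 1 → y ∈ Icc (0 : ℝ) 1 → ∫ z in x..y, p₂ z = q₂ y - q₂ x)
    (hq₁0 : q₁ 0 = 0) (hq₂0 : q₂ 0 = 0) (hq₁1 : q₁ 1 = Φ) (hq₂1 : q₂ 1 = Φ)
    (hs : Measurable s) (hs1 : ∀ y, |s y| ≤ 1) (hsd : ∀ y, s y * (p₁ y - p₂ y) = |p₁ y - p₂ y|)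
    (hψ0 : 0 ≤ ψ) (hψ1 : ψ < Φ) :
    (0 ≤ ∫ y in (0 : ℝ)..1, s y * (above q₁ p₁ ψ y - above q₂ p₂ ψ y)) ∧
      (∫ y in (0 : ℝ)..1, s y * (above q₁ p₁ ψ y - above q₂ p₂ ψ y)) ≤
        ∫ y in (0 : ℝ)..1, |p₁ y - p₂ y| := by
  have mono : ∀ {p q : ℝ → ℝ}, (∀ y, 0 ≤ p y) → (∀ x y, x ∈ Icc (0 : ℝ) 1 → y ∈ Icc (0 : ℝ) 1 →
      ∫ z in x..y, p z = q y - q x) → MonotoneOn q (Icc 0 1) := by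
    intro p q hp hq x hx y hy hxy
    have := intervalIntegral.integral_nonneg hxy (μ := volume) fun z _ => hp z
    rw [hq x y hx hy] at this
    linarith
  obtain ⟨η₁, h₁, e₁, l₁⟩ := exists_level cq₁ (mono hp₁ hq₁) (hq₁0.trans_le hψ0)
    (hψ1.trans_eq hq₁1.symm)
  obtain ⟨η₂, h₂, e₂, l₂⟩ := exists_level cq₂ (mono hp₂ hq₂) (hq₂0.trans_le hψ0)
    (hψ1.trans_eq hq₂1.symm)
  rcases le_total η₁ η₂ with hle | hle
  · exact level_bounds_aux cp₁ cp₂ hp₁ hp₂ hq₁ hq₂ hq₁0 hq₂0 hq₁1 hq₂1 hs hs1 hsd h₁ h₂ e₁ e₂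
      l₁ l₂ hle
  -- Exchanging the two profiles reverses the sign of `p₁ - p₂`, hence `-s`; the integrand is
  -- unchanged.
  · have := level_bounds_aux (s := fun y => -s y) cp₂ cp₁ hp₂ hp₁ hq₂ hq₁ hq₂0 hq₁0 hq₂1 hq₁1
      hs.neg (fun y => by rw [abs_neg]; exact hs1 y)
      (fun y => by rw [abs_sub_comm, ← hsd]; ring) h₂ h₁ e₂ e₁ l₂ l₁ hle
    have e : ∀ y, -s y * (above q₂ p₂ ψ y - above q₁ p₁ ψ y) =
      s y * (above q₁ p₁ ψ y - above q₂ p₂ ψ y) := fun y => by ring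
    simp only [e, abs_sub_comm (p₂ _)] at this
    exact this

/-- Layer-cake representation of `k (q y)`. -/
lemma comp_eq_integral_levels {k : ℝ → ℝ} (hk : ContDiff ℝ 1 k) {Φ u : ℝ} (hu0 : 0 ≤ u)
    (hu1 : u ≤ Φ) : k u = k 0 + ∫ ψ in (0 : ℝ)..Φ, if ψ < u then deriv k ψ else 0 := by
  have ck : Continuous (deriv k) := hk.continuous_deriv le_rfl
  have e1 : EqOn (deriv k) (fun ψ => if ψ < u then deriv k ψ else 0) (Ioo 0 u) := by
    intro ψ hψ
    simp [hψ.2]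
  have e2 : EqOn (fun _ => (0 : ℝ)) (fun ψ => if ψ < u then deriv k ψ else 0) (uIoc u Φ) := by
    intro ψ hψ
    rw [uIoc_of_le hu1] at hψ
    simp [hψ.1.le, not_lt]
  have e1' : ∀ᵐ ψ ∂volume, ψ ∈ uIoc 0 u →
      deriv k ψ = if ψ < u then deriv k ψ else 0 := by
    filter_upwards [compl_mem_ae_iff.2 (Real.volume_singleton (a := u))] with ψ hne hψ
    rw [uIoc_of_le hu0] at hψ
    exact e1 ⟨hψ.1, hψ.2.lt_of_ne hne⟩
  have i1 : IntervalIntegrable (fun ψ => if ψ < u then deriv k ψ else 0) volume 0 u :=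
    (ck.intervalIntegrable 0 u).congr_ae
      ((ae_restrict_iff' measurableSet_uIoc).2 e1')
  have i2 : IntervalIntegrable (fun ψ => if ψ < u then deriv k ψ else 0) volume u Φ :=
    (intervalIntegrable_const (c := (0 : ℝ))).congr e2
  rw [← intervalIntegral.integral_add_adjacent_intervals i1 i2,
    ← intervalIntegral.integral_congr_ae e1', ← integral_congr_of_eqOn_uIoc e2,
    intervalIntegral.integral_deriv_eq_sub
      (fun x _ => (hk.differentiable one_ne_zero).differentiableAt) (ck.intervalIntegrable _ _)]
  simp

/-- The production term of the `L¹` distance at a fixed time. -/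
theorem production_le {k p₁ p₂ q₁ q₂ s : ℝ → ℝ} {Φ : ℝ} (hΦ : 0 ≤ Φ) (hk : ContDiff ℝ 1 k)
    (cp₁ : Continuous p₁) (cp₂ : Continuous p₂) (cq₁ : Continuous q₁) (cq₂ : Continuous q₂)
    (hp₁ : ∀ y, 0 ≤ p₁ y) (hp₂ : ∀ y, 0 ≤ p₂ y)
    (hq₁ : ∀ x y, x ∈ Icc (0 : ℝ) 1 → y ∈ Icc (0 : ℝ) 1 → ∫ z in x..y, p₁ z = q₁ y - q₁ x)
    (hq₂ : ∀ x y, x ∈ Icc (0 : ℝ) 1 → y ∈ Icc (0 : ℝ) 1 → ∫ z in x..y, p₂ z = q₂ y - q₂ x)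
    (hq₁0 : q₁ 0 = 0) (hq₂0 : q₂ 0 = 0) (hq₁1 : q₁ 1 = Φ) (hq₂1 : q₂ 1 = Φ)
    (hs : Measurable s) (hs1 : ∀ y, |s y| ≤ 1)
    (hsd : ∀ y, s y * (p₁ y - p₂ y) = |p₁ y - p₂ y|) :
    (∫ y in (0 : ℝ)..1, s y * (k (q₁ y) * p₁ y - k (q₂ y) * p₂ y)) ≤
      (k 0 + ∫ ψ in (0 : ℝ)..Φ, max (deriv k ψ) 0) * ∫ y in (0 : ℝ)..1, |p₁ y - p₂ y| := by
  have ck : Continuous (deriv k) := hk.continuous_deriv le_rfl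
  set g : ℝ → ℝ → ℝ := fun y ψ => deriv k ψ * (s y * (above q₁ p₁ ψ y - above q₂ p₂ ψ y)) with hg
  have range : ∀ {p q : ℝ → ℝ}, (∀ y, 0 ≤ p y) → (∀ x y, x ∈ Icc (0 : ℝ) 1 → y ∈ Icc (0 : ℝ) 1 →
      ∫ z in x..y, p z = q y - q x) → q 0 = 0 → q 1 = Φ → ∀ y ∈ Icc (0 : ℝ) 1,
      0 ≤ q y ∧ q y ≤ Φ := by
    intro p q hp hq h0 h1 y hy
    have a1 := intervalIntegral.integral_nonneg hy.1 (μ := volume) fun z _ => hp z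
    have a2 := intervalIntegral.integral_nonneg hy.2 (μ := volume) fun z _ => hp z
    rw [hq _ _ (by simp) hy] at a1
    rw [hq _ _ hy (by simp)] at a2
    constructor <;> linarith
  have r₁ := range hp₁ hq₁ hq₁0 hq₁1
  have r₂ := range hp₂ hq₂ hq₂0 hq₂1
  have m_ite : ∀ u : ℝ, Measurable fun ψ => if ψ < u then deriv k ψ else 0 := fun u =>
    Measurable.ite measurableSet_Iio ck.measurable measurable_const
  have i_ite : ∀ u : ℝ, IntervalIntegrable (fun ψ => if ψ < u then deriv k ψ else 0)
      volume 0 Φ := by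
    intro u
    refine (ck.intervalIntegrable 0 Φ).mono_fun (m_ite u).aestronglyMeasurable
      (Eventually.of_forall fun ψ => ?_)
    simp only
    split_ifs <;> simp
  have inner : ∀ y ∈ Icc (0 : ℝ) 1, s y * (k (q₁ y) * p₁ y - k (q₂ y) * p₂ y) =
      k 0 * |p₁ y - p₂ y| + ∫ ψ in (0 : ℝ)..Φ, g y ψ := by
    intro y hy
    have e : ∀ ψ, g y ψ = (s y * p₁ y) * (if ψ < q₁ y then deriv k ψ else 0) -
        (s y * p₂ y) * (if ψ < q₂ y then deriv k ψ else 0) := by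
      intro ψ
      simp only [hg, above]
      split_ifs <;> ring
    simp only [e]
    rw [intervalIntegral.integral_sub ((i_ite _).const_mul _) ((i_ite _).const_mul _),
      intervalIntegral.integral_const_mul, intervalIntegral.integral_const_mul, ← hsd,
      comp_eq_integral_levels hk (r₁ y hy).1 (r₁ y hy).2,
      comp_eq_integral_levels hk (r₂ y hy).1 (r₂ y hy).2]
    ring
  have m_above : ∀ {q p : ℝ → ℝ}, Continuous q → Continuous p →
      Measurable fun z : ℝ × ℝ => above q p z.2 z.1 := fun {q p} cq cp =>
    Measurable.ite (measurableSet_lt measurable_snd (cq.measurable.comp measurable_fst))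
      (cp.measurable.comp measurable_fst) measurable_const
  have gm : Measurable (Function.uncurry g) :=
    (ck.measurable.comp measurable_snd).mul ((hs.comp measurable_fst).mul
      ((m_above cq₁ cp₁).sub (m_above cq₂ cp₂)))
  have a_le : ∀ {q p : ℝ → ℝ}, (∀ y, 0 ≤ p y) → ∀ ψ y, |above q p ψ y| ≤ p y := by
    intro q p hp ψ y
    unfold above
    split_ifs
    · rw [abs_of_nonneg (hp y)]
    · simpa using hp y
  have gb : ∀ y ψ, ‖g y ψ‖ ≤ |deriv k ψ| * (p₁ y + p₂ y) := by
    intro y ψ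
    simp only [hg, norm_mul, Real.norm_eq_abs]
    refine mul_le_mul_of_nonneg_left ?_ (abs_nonneg _)
    calc |s y| * |above q₁ p₁ ψ y - above q₂ p₂ ψ y|
        ≤ 1 * |above q₁ p₁ ψ y - above q₂ p₂ ψ y| := by gcongr; exact hs1 y
      _ ≤ p₁ y + p₂ y := by
        rw [one_mul]
        exact (abs_sub _ _).trans (add_le_add (a_le hp₁ _ _) (a_le hp₂ _ _))
  have gi : Integrable (Function.uncurry g)
      ((volume.restrict (uIoc (0 : ℝ) 1)).prod (volume.restrict (uIoc 0 Φ))) := by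
    rw [Measure.prod_restrict]
    have : IntegrableOn (fun z : ℝ × ℝ => |deriv k z.2| * (p₁ z.1 + p₂ z.1))
        (uIoc (0 : ℝ) 1 ×ˢ uIoc 0 Φ) (volume.prod volume) := by
      refine IntegrableOn.mono_set (t := Icc (0 : ℝ) 1 ×ˢ Icc 0 Φ) ?_ ?_
      · exact ContinuousOn.integrableOn_compact (isCompact_Icc.prod isCompact_Icc)
          (by fun_prop)
      · rw [uIoc_of_le zero_le_one, uIoc_of_le hΦ]
        exact prod_mono Ioc_subset_Icc_self Ioc_subset_Icc_self
    exact Integrable.mono' this gm.aestronglyMeasurable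
      (Eventually.of_forall fun z => gb z.1 z.2)
  have gi1 : IntervalIntegrable (fun y => ∫ ψ in (0 : ℝ)..Φ, g y ψ) volume 0 1 := by
    rw [intervalIntegrable_iff]
    simp only [intervalIntegral.integral_of_le hΦ, ← uIoc_of_le hΦ]
    exact gi.integral_prod_left
  have gi2 : IntervalIntegrable (fun ψ => ∫ y in (0 : ℝ)..1, g y ψ) volume 0 Φ := by
    rw [intervalIntegrable_iff]
    simp only [intervalIntegral.integral_of_le zero_le_one, ← uIoc_of_le zero_le_one (α := ℝ)]
    exact gi.integral_prod_right
  have cabs : Continuous fun y => |p₁ y - p₂ y| := (cp₁.sub cp₂).abs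
  have e1 : (∫ y in (0 : ℝ)..1, s y * (k (q₁ y) * p₁ y - k (q₂ y) * p₂ y)) =
      k 0 * (∫ y in (0 : ℝ)..1, |p₁ y - p₂ y|) +
        ∫ ψ in (0 : ℝ)..Φ, ∫ y in (0 : ℝ)..1, g y ψ := by
    rw [intervalIntegral.integral_congr (g := fun y => k 0 * |p₁ y - p₂ y| +
        ∫ ψ in (0 : ℝ)..Φ, g y ψ) (fun y hy => inner y (by rwa [uIcc_of_le zero_le_one] at hy)),
      intervalIntegral.integral_add ((cabs.intervalIntegrable _ _).const_mul _) gi1,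
      intervalIntegral.integral_const_mul, intervalIntegral_intervalIntegral_swap (by rwa [Measure.prod_restrict] at gi)]
  rw [e1, add_mul, ← intervalIntegral.integral_mul_const]
  refine add_le_add_right ?_ _
  have cmax : Continuous fun ψ => max (deriv k ψ) 0 := ck.max continuous_const
  -- Open interval, since `level_bounds` needs `ψ < Φ`.
  refine intervalIntegral.integral_mono_on_of_le_Ioo hΦ gi2
    ((cmax.mul continuous_const).intervalIntegrable _ _) fun ψ hψ => ?_
  simp only [hg, intervalIntegral.integral_const_mul]
  obtain ⟨b1, b2⟩ := level_bounds cp₁ cp₂ cq₁ cq₂ hp₁ hp₂ hq₁ hq₂ hq₁0 hq₂0 hq₁1 hq₂1 hs hs1 hsd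
    hψ.1.le hψ.2
  calc _ ≤ max (deriv k ψ) 0 * _ := mul_le_mul_of_nonneg_right (le_max_left _ _) b1
    _ ≤ _ := mul_le_mul_of_nonneg_left b2 (le_max_right _ _)

end PulseCoupled

/-! ### Mild solutions and the equation for `∂_η q` -/

namespace PulseCoupled

/-- A classical solution on `[0, b] × [0, 1]` in integrated form, extended continuously to the
plane: `q` is the phase profile, `p = ∂_η q`, and `a` is the interaction term. -/
structure IsMildSolution (K : ℝ → ℝ) (Φ b : ℝ) (q p : ℝ → ℝ → ℝ) (a : ℝ → ℝ) : Prop where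
  continuous_q : Continuous (Function.uncurry q)
  continuous_p : Continuous (Function.uncurry p)
  continuous_a : Continuous a
  nonneg : ∀ t y, 0 ≤ p t y
  integral_p : ∀ t ∈ Icc 0 b, ∀ x y, x ∈ Icc (0 : ℝ) 1 → y ∈ Icc (0 : ℝ) 1 →
    ∫ z in x..y, p t z = q t y - q t x
  at_zero : ∀ t ∈ Icc 0 b, q t 0 = 0
  at_one : ∀ t ∈ Icc 0 b, q t 1 = Φ
  boundary : ∀ t ∈ Icc 0 b, p t 0 - p t 1 = K 0 - K Φ
  transport : ∀ x h y, 0 ≤ x → 0 ≤ h → x + h ≤ b → 0 ≤ y → y + h ≤ 1 →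
    q (x + h) (y + h) - q x y = ∫ s in (0 : ℝ)..h, (a (x + s) + K (q (x + s) (y + s)))

lemma eq_zero_of_integral_eq_zero {G : ℝ → ℝ} (hG : Continuous G) {c : ℝ} (hc : 0 < c)
    (h : ∀ z ∈ Icc 0 c, ∫ w in (0 : ℝ)..z, G w = 0) {y : ℝ} (hy : y ∈ Icc 0 c) : G y = 0 := by
  have h1 : HasDerivWithinAt (fun z => ∫ w in (0 : ℝ)..z, G w) (G y) (Icc 0 c) y :=
    (hG.integral_hasStrictDerivAt 0 y).hasDerivAt.hasDerivWithinAt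
  have h2 : HasDerivWithinAt (fun z => ∫ w in (0 : ℝ)..z, G w) 0 (Icc 0 c) y :=
    (hasDerivWithinAt_const y (Icc 0 c) (0 : ℝ)).congr h (h y hy)
  exact (uniqueDiffOn_Icc hc y hy).eq_deriv _ h1 h2

namespace IsMildSolution

variable {K : ℝ → ℝ} {Φ b : ℝ} {q p : ℝ → ℝ → ℝ} {a : ℝ → ℝ}

lemma hasDerivAt (h : IsMildSolution K Φ b q p a) {t y : ℝ} (ht : t ∈ Icc 0 b)
    (hy : y ∈ Ioo (0 : ℝ) 1) : HasDerivAt (q t) (p t y) y := by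
  have cp : Continuous (p t) := h.continuous_p.comp (Continuous.prodMk_right t)
  have h1 := (cp.integral_hasStrictDerivAt 0 y).hasDerivAt
  refine h1.congr_of_eventuallyEq ?_
  filter_upwards [Ioo_mem_nhds hy.1 hy.2] with z hz
  rw [h.integral_p t ht 0 z (by simp) (Ioo_subset_Icc_self hz), h.at_zero t ht, sub_zero]

/-- The chain rule for `K ∘ q t`, integrated. The shift `s` is the displacement along
characteristics after time `s`. -/
lemma integral_comp (h : IsMildSolution K Φ b q p a) (hK : ContDiff ℝ 1 K) {t s z : ℝ}
    (ht : t ∈ Icc 0 b) (hs : 0 ≤ s) (hz : 0 ≤ z) (hzs : z + s ≤ 1) :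
    ∫ w in (0 : ℝ)..z, deriv K (q t (w + s)) * p t (w + s) = K (q t (z + s)) - K (q t s) := by
  have cp : Continuous (p t) := h.continuous_p.comp (Continuous.prodMk_right t)
  have cq : Continuous (q t) := h.continuous_q.comp (Continuous.prodMk_right t)
  have ck : Continuous (deriv K) := hK.continuous_deriv le_rfl
  have cK := hK.continuous
  have := intervalIntegral.integral_eq_sub_of_hasDerivAt_of_le (f := fun w => K (q t (w + s)))
    (f' := fun w => deriv K (q t (w + s)) * p t (w + s)) hz (by fun_prop) (fun w hw => by
      have h1 := (h.hasDerivAt ht (y := w + s) ⟨by linarith [hw.1], by linarith [hw.2]⟩)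
      have h2 : HasDerivAt (fun w => q t (w + s)) (p t (w + s)) w := h1.comp_add_const w s
      have h3 : HasDerivAt K (deriv K (q t (w + s))) (q t (w + s)) :=
        (hK.differentiable one_ne_zero _).hasDerivAt
      exact h3.comp w h2) (Continuous.intervalIntegrable (by fun_prop) _ _)
  simpa using this

/-- The equation for `p = ∂_η q` along the characteristics. -/
lemma transport_deriv (hq : IsMildSolution K Φ b q p a) (hK : ContDiff ℝ 1 K) {x h y : ℝ}
    (hx : 0 ≤ x) (hh : 0 ≤ h) (hh1 : h < 1) (hxb : x + h ≤ b) (hy : 0 ≤ y) (hyh : y + h ≤ 1) :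
    p (x + h) (y + h) = p x y +
      ∫ s in (0 : ℝ)..h, deriv K (q (x + s) (y + s)) * p (x + s) (y + s) := by
  have ck : Continuous (deriv K) := hK.continuous_deriv le_rfl
  have cK := hK.continuous
  have ca := hq.continuous_a
  have cq : ∀ {f g : ℝ × ℝ → ℝ}, Continuous f → Continuous g →
      Continuous fun z => q (f z) (g z) := fun hf hg => hq.continuous_q.comp (hf.prodMk hg)
  have cp : ∀ {f g : ℝ × ℝ → ℝ}, Continuous f → Continuous g →
      Continuous fun z => p (f z) (g z) := fun hf hg => hq.continuous_p.comp (hf.prodMk hg)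
  have cq1 : ∀ {f g : ℝ → ℝ}, Continuous f → Continuous g →
      Continuous fun z => q (f z) (g z) := fun hf hg => hq.continuous_q.comp (hf.prodMk hg)
  have cp1 : ∀ {f g : ℝ → ℝ}, Continuous f → Continuous g →
      Continuous fun z => p (f z) (g z) := fun hf hg => hq.continuous_p.comp (hf.prodMk hg)
  set F : ℝ → ℝ → ℝ := fun w s => deriv K (q (x + s) (w + s)) * p (x + s) (w + s) with hF
  have cF : Continuous (Function.uncurry F) :=
    (ck.comp (cq (by fun_prop) (by fun_prop))).mul (cp (by fun_prop) (by fun_prop))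
  set G : ℝ → ℝ := fun w => p (x + h) (w + h) - p x w - ∫ s in (0 : ℝ)..h, F w s with hG
  have cI : Continuous fun w => ∫ s in (0 : ℝ)..h, F w s :=
    intervalIntegral.continuous_parametric_intervalIntegral_of_continuous' cF 0 h
  have c1 : Continuous fun w => p (x + h) (w + h) := cp1 (by fun_prop) (by fun_prop)
  have c2 : Continuous fun w => p x w := cp1 (by fun_prop) (by fun_prop)
  have c3 : Continuous fun w => p (x + h) (w + h) - p x w := c1.sub c2
  have cG : Continuous G := c3.sub cI
  suffices hz : G y = 0 by
    simp only [hG] at hz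
    linarith
  -- The identity for `p` is checked after integration in the starting point `w`, where it is the
  -- difference of two transport identities for `q`. The strict bound `h < 1` makes `[0, 1 - h]`
  -- nondegenerate.
  refine eq_zero_of_integral_eq_zero cG (c := 1 - h) (by linarith) (fun z hz => ?_)
    ⟨hy, by linarith⟩
  have hz2 := hz.2
  simp only [hG]
  rw [intervalIntegral.integral_sub (c3.intervalIntegrable _ _)
    (cI.intervalIntegrable _ _), intervalIntegral.integral_sub (c1.intervalIntegrable _ _)
    (c2.intervalIntegrable _ _), intervalIntegral.integral_comp_add_right (p (x + h)) h,
    hq.integral_p _ ⟨by linarith, hxb⟩ _ _ ⟨by linarith, by linarith⟩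
      ⟨by linarith [hz.1], by linarith⟩,
    hq.integral_p _ ⟨hx, by linarith⟩ _ _ (by simp) ⟨hz.1, by linarith⟩,
    intervalIntegral_intervalIntegral_swap]
  -- The interaction term `a` does not depend on the phase and cancels between the characteristics
  -- from `z` and from `0`.
  · have e : ∫ s in (0 : ℝ)..h, ∫ w in (0 : ℝ)..z, F w s =
        ∫ s in (0 : ℝ)..h, ((a (x + s) + K (q (x + s) (z + s))) -
          (a (x + s) + K (q (x + s) (0 + s)))) := by
      refine intervalIntegral.integral_congr fun s hs => ?_
      rw [uIcc_of_le hh] at hs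
      simp only [hF]
      rw [hq.integral_comp hK ⟨by linarith [hs.1], by linarith [hs.2]⟩ hs.1 hz.1
        (by linarith [hs.2]), zero_add]
      ring
    have i : ∀ z, IntervalIntegrable (fun s => a (x + s) + K (q (x + s) (z + s))) volume 0 h :=
      fun z => Continuous.intervalIntegrable ((ca.comp (by fun_prop)).add
        (cK.comp (cq1 (by fun_prop) (by fun_prop)))) _ _
    rw [e, intervalIntegral.integral_sub (i z) (i 0),
      ← hq.transport x h z hx hh hxb hz.1 (by linarith),
      ← hq.transport x h 0 hx hh hxb le_rfl (by linarith)]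
    ring
  · have := cF.continuousOn.integrableOn_compact (μ := volume)
      ((isCompact_uIcc (a := (0 : ℝ)) (b := z)).prod (isCompact_uIcc (a := (0 : ℝ)) (b := h)))
    exact this.mono_set (prod_mono uIoc_subset_uIcc uIoc_subset_uIcc)

end IsMildSolution

end PulseCoupled

/-! ### From classical to mild solutions -/

namespace PulseCoupled

/-- The projection of the real line onto `[0, c]`. -/
noncomputable def clamp (c x : ℝ) : ℝ := max 0 (min c x)

lemma continuous_clamp (c : ℝ) : Continuous (clamp c) := by
  unfold clamp; fun_prop

lemma clamp_mem {c : ℝ} (hc : 0 ≤ c) (x : ℝ) : clamp c x ∈ Icc 0 c :=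
  ⟨le_max_left _ _, max_le hc (min_le_left _ _)⟩

lemma clamp_of_mem {c x : ℝ} (hx : x ∈ Icc 0 c) : clamp c x = x := by
  unfold clamp
  rw [min_eq_right hx.2, max_eq_right hx.1]

namespace IsClassicalSolution

variable {K : ℝ → ℝ} {Φ : ℝ} {Qinit : ℝ → ℝ} {T : EReal} {Q : ℝ → ℝ → ℝ} {N : ℝ → ℝ} {b : ℝ}

lemma mem_timeInterval (hbT : (b : EReal) < T) {t : ℝ} (ht : t ∈ Icc 0 b) :
    t ∈ timeInterval T :=
  ⟨ht.1, (EReal.coe_le_coe_iff.2 ht.2).trans_lt hbT⟩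

/-- The total derivative on the closed rectangle `[0, b] × [0, 1]`, with the equation extended
to the boundary. -/
lemma exists_fderiv (h : IsClassicalSolution K Φ Qinit T Q N) (hK : Continuous K) (hb : 0 < b)
    (hbT : (b : EReal) < T) : ∃ L : ℝ × ℝ → (ℝ × ℝ →L[ℝ] ℝ),
      ContinuousOn L (Icc 0 b ×ˢ Icc 0 1) ∧
      (∀ z ∈ Icc 0 b ×ˢ Icc (0 : ℝ) 1, HasFDerivWithinAt (fun z : ℝ × ℝ => Q z.1 z.2) (L z)
        (Icc 0 b ×ˢ Icc 0 1) z) ∧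
      (∀ t ∈ Icc 0 b, ∀ y ∈ Icc (0 : ℝ) 1,
        HasDerivWithinAt (Q t) (L (t, y) (0, 1)) (Icc 0 1) y) ∧
      (∀ t ∈ Icc 0 b, ∀ y ∈ Icc (0 : ℝ) 1,
        HasDerivWithinAt (fun s => Q s y) (L (t, y) (1, 0)) (Icc 0 b) t) ∧
      (∀ t ∈ Icc 0 b, ∀ y ∈ Icc (0 : ℝ) 1,
        L (t, y) (1, 0) + L (t, y) (0, 1) = 1 / N t + K (Q t y)) ∧
      (∀ t ∈ Icc 0 b, 1 / N t = L (t, 1) (0, 1) - K Φ) := by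
  set S : Set (ℝ × ℝ) := Icc 0 b ×ˢ Icc 0 1 with hS
  have hf : ContDiffOn ℝ 1 (fun z : ℝ × ℝ => Q z.1 z.2) S :=
    h.contDiffOn.mono (prod_mono (fun t ht => mem_timeInterval hbT ht) subset_rfl)
  have hU : UniqueDiffOn ℝ S := (uniqueDiffOn_Icc hb).prod (uniqueDiffOn_Icc zero_lt_one)
  set L := fderivWithin ℝ (fun z : ℝ × ℝ => Q z.1 z.2) S with hL
  have cL : ContinuousOn L S := hf.continuousOn_fderivWithin hU le_rfl
  have dL : ∀ z ∈ S, HasFDerivWithinAt (fun z : ℝ × ℝ => Q z.1 z.2) (L z) S z := fun z hz =>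
    (hf.differentiableOn one_ne_zero z hz).hasFDerivWithinAt
  have dy : ∀ t ∈ Icc 0 b, ∀ y ∈ Icc (0 : ℝ) 1,
      HasDerivWithinAt (Q t) (L (t, y) (0, 1)) (Icc 0 1) y := fun t ht y hy =>
    HasFDerivWithinAt.comp_hasDerivWithinAt (f := fun s => (t, s)) y (dL (t, y) ⟨ht, hy⟩)
      ((hasDerivWithinAt_const y _ t).prodMk (hasDerivWithinAt_id y _)) fun s hs => ⟨ht, hs⟩
  have dt : ∀ t ∈ Icc 0 b, ∀ y ∈ Icc (0 : ℝ) 1,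
      HasDerivWithinAt (fun s => Q s y) (L (t, y) (1, 0)) (Icc 0 b) t := fun t ht y hy =>
    HasFDerivWithinAt.comp_hasDerivWithinAt (f := fun s => (s, y)) t (dL (t, y) ⟨ht, hy⟩)
      ((hasDerivWithinAt_id t _).prodMk (hasDerivWithinAt_const t _ y)) fun s hs => ⟨hs, hy⟩
  have cN : ContinuousOn (fun t => 1 / N t) (Icc 0 b) :=
    ContinuousOn.div continuousOn_const
      (h.continuousOn_N.mono fun t ht => mem_timeInterval hbT ht)
      fun t ht => (h.N_pos t (mem_timeInterval hbT ht)).ne'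
  have cQ : ContinuousOn (fun z : ℝ × ℝ => Q z.1 z.2) S := hf.continuousOn
  refine ⟨L, cL, dL, dy, dt, ?_, ?_⟩
  -- Both sides are continuous on the closed rectangle and agree on its interior, which is dense.
  · have key : EqOn (fun z : ℝ × ℝ => L z (1, 0) + L z (0, 1))
        (fun z => 1 / N z.1 + K (Q z.1 z.2)) S := by
      refine Set.EqOn.of_subset_closure (s := Ioo 0 b ×ˢ Ioo 0 1) ?_
        ((cL.clm_apply continuousOn_const).add (cL.clm_apply continuousOn_const))
        ((cN.comp continuousOn_fst fun z hz => hz.1).add (hK.comp_continuousOn cQ))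
        (prod_mono Ioo_subset_Icc_self Ioo_subset_Icc_self) ?_
      · rintro ⟨t, y⟩ ⟨ht, hy⟩
        have ht' := Ioo_subset_Icc_self ht
        have hy' := Ioo_subset_Icc_self hy
        have := h.equation t (mem_timeInterval hbT ht') ht.1 y hy
        rw [((dt t ht' y hy').hasDerivAt (Icc_mem_nhds ht.1 ht.2)).deriv, dEta,
          (dy t ht' y hy').derivWithin (uniqueDiffOn_Icc zero_lt_one y hy')] at this
        exact this
      · rw [closure_prod_eq, closure_Ioo hb.ne, closure_Ioo zero_ne_one]
    exact fun t ht y hy => key (x := (t, y)) ⟨ht, hy⟩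
  · have m1 : (1 : ℝ) ∈ Icc (0 : ℝ) 1 := by simp
    have c1 : ContinuousOn (fun t => L (t, 1)) (Icc 0 b) :=
      cL.comp (f := fun t : ℝ => (t, (1 : ℝ))) (by fun_prop) fun t ht => ⟨ht, m1⟩
    refine Set.EqOn.of_subset_closure (s := Ioo 0 b) (fun t ht => ?_) cN
      ((c1.clm_apply continuousOn_const).sub continuousOn_const) Ioo_subset_Icc_self
      (closure_Ioo hb.ne).ge
    have ht' := Ioo_subset_Icc_self ht
    have := h.firing_rate t (mem_timeInterval hbT ht') ht.1
    rw [dEta, (dy t ht' 1 m1).derivWithin (uniqueDiffOn_Icc zero_lt_one 1 m1)] at this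
    exact this

lemma apply_zero (h : IsClassicalSolution K Φ Qinit T Q N) {t : ℝ} (ht : t ∈ timeInterval T) :
    Q t 0 = 0 := by
  rcases ht.1.eq_or_lt with rfl | h0
  · rw [h.initial 0 (by simp), h.init_datum.at_zero]
  · exact h.boundary t ht h0

/-- Clamping freezes the data outside `[0, b] × [0, 1]`, so that all functions are continuous on the
whole plane. -/
lemma isMildSolution (h : IsClassicalSolution K Φ Qinit T Q N) (hK : IsPhaseResponse K Φ)
    (hb : 0 < b) (hbT : (b : EReal) < T) :
    IsMildSolution K Φ b (fun t y => Q (clamp b t) (clamp 1 y))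
      (fun t y => dEta (Q (clamp b t)) (clamp 1 y)) (fun t => 1 / N (clamp b t)) := by
  have hKc := hK.contDiff.continuous
  obtain ⟨L, cL, dL, dy, dt, heq, hN⟩ := h.exists_fderiv hKc hb hbT
  have cQ : ContinuousOn (fun z : ℝ × ℝ => Q z.1 z.2) (Icc 0 b ×ˢ Icc 0 1) :=
    fun z hz => (dL z hz).continuousWithinAt
  have eta : ∀ t ∈ Icc 0 b, ∀ y ∈ Icc (0 : ℝ) 1, dEta (Q t) y = L (t, y) (0, 1) :=
    fun t ht y hy => (dy t ht y hy).derivWithin (uniqueDiffOn_Icc zero_lt_one y hy)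
  have cm : ∀ t, clamp b t ∈ Icc 0 b := clamp_mem hb.le
  have cm1 : ∀ y, clamp 1 y ∈ Icc (0 : ℝ) 1 := clamp_mem zero_le_one
  have cc : Continuous fun z : ℝ × ℝ => (clamp b z.1, clamp 1 z.2) :=
    ((continuous_clamp b).comp continuous_fst).prodMk ((continuous_clamp 1).comp continuous_snd)
  have m0 : (0 : ℝ) ∈ Icc (0 : ℝ) 1 := by simp
  have m1 : (1 : ℝ) ∈ Icc (0 : ℝ) 1 := by simp
  have cq : Continuous fun z : ℝ × ℝ => Q (clamp b z.1) (clamp 1 z.2) :=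
    cQ.comp_continuous cc fun z => ⟨cm _, cm1 _⟩
  have cp : Continuous fun z : ℝ × ℝ => dEta (Q (clamp b z.1)) (clamp 1 z.2) := by
    simp only [eta _ (cm _) _ (cm1 _)]
    exact (cL.comp_continuous cc fun z => ⟨cm _, cm1 _⟩).clm_apply continuous_const
  have ca : Continuous fun t => 1 / N (clamp b t) := by
    refine continuous_const.div (h.continuousOn_N.comp_continuous (continuous_clamp b)
      fun t => mem_timeInterval hbT (cm t)) fun t => (h.N_pos _ (mem_timeInterval hbT (cm t))).ne'
  -- At `η = 1` the equation and the firing condition give `∂_τ Q = K(Q) - K(Φ)`, for which `Φ` is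
  -- an equilibrium. Bounded `K'` makes the field Lipschitz, so `Q` stays at `Φ`.
  have hone : ∀ t ∈ Icc 0 b, Q t 1 = Φ := by
    obtain ⟨C, hC⟩ := hK.bounded_deriv
    have hC0 : 0 ≤ C := (abs_nonneg _).trans (hC 0)
    have lip : LipschitzWith ⟨C, hC0⟩ K :=
      lipschitzWith_of_nnnorm_deriv_le (hK.contDiff.differentiable two_ne_zero) fun x => hC x
    have lip' : LipschitzWith ⟨C, hC0⟩ fun u => K u - K Φ := by
      refine LipschitzWith.of_dist_le_mul fun u v => ?_
      rw [dist_sub_right]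
      exact lip.dist_le_mul u v
    refine ODE_solution_unique (v := fun _ u => K u - K Φ) (g := fun _ => Φ) (fun _ => lip')
      (fun t ht => (dt t ht 1 m1).continuousWithinAt) (fun t ht => ?_) continuousOn_const
      (fun t _ => by simpa using hasDerivWithinAt_const t (Ici t) Φ) ?_
    · have ht' := Ico_subset_Icc_self ht
      have e1 := heq t ht' 1 m1
      have e2 := hN t ht'
      have e3 : K (Q t 1) - K Φ = L (t, 1) (1, 0) := by linarith
      simp only [e3]
      refine (dt t ht' 1 m1).mono_of_mem_nhdsWithin ?_
      exact mem_of_superset (Icc_mem_nhdsGE ht.2) (Icc_subset_Icc_left ht.1)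
    · rw [h.initial 1 m1, h.init_datum.at_one]
  refine ⟨cq, cp, ca, fun t y => MonotoneOn.derivWithin_nonneg
    (h.monotoneOn _ (mem_timeInterval hbT (cm t))), ?_, ?_, ?_, ?_, ?_⟩
  · intro t ht
    have ordered : ∀ x y, x ∈ Icc (0 : ℝ) 1 → y ∈ Icc (0 : ℝ) 1 → x ≤ y →
        ∫ z in x..y, dEta (Q t) (clamp 1 z) = Q t y - Q t x := by
      intro x y hx hy hxy
      have sub : Icc x y ⊆ Icc 0 1 := Icc_subset_Icc hx.1 hy.2
      have cp' : Continuous fun z => dEta (Q t) (clamp 1 z) := by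
        have := cp.comp (Continuous.prodMk_right t)
        simpa only [Function.comp_def, clamp_of_mem ht] using this
      refine intervalIntegral.integral_eq_sub_of_hasDerivAt_of_le hxy
        (fun z hz => ((dy t ht z (sub hz)).continuousWithinAt).mono sub) (fun z hz => ?_)
        (cp'.intervalIntegrable _ _)
      have hz' := sub (Ioo_subset_Icc_self hz)
      rw [clamp_of_mem hz', eta t ht z hz']
      exact (dy t ht z hz').hasDerivAt
        (Icc_mem_nhds (hx.1.trans_lt hz.1) (hz.2.trans_le hy.2))
    intro x y hx hy
    simp only [clamp_of_mem ht, clamp_of_mem hx, clamp_of_mem hy]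
    rcases le_total x y with hxy | hxy
    · exact ordered x y hx hy hxy
    · rw [intervalIntegral.integral_symm, ordered y x hy hx hxy]
      ring
  · intro t ht
    simp only [clamp_of_mem ht, clamp_of_mem m0]
    exact h.apply_zero (mem_timeInterval hbT ht)
  · intro t ht
    simp only [clamp_of_mem ht, clamp_of_mem m1]
    exact hone t ht
  · intro t ht
    simp only [clamp_of_mem ht, clamp_of_mem m0, clamp_of_mem m1, eta t ht 0 m0, eta t ht 1 m1]
    have e0 := heq t ht 0 m0
    have e2 := hN t ht
    -- `Q` vanishes identically on `η = 0`, so its time derivative does too, and the equation gives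
    -- `∂_η Q(t, 0) = 1 / N t + K 0`.
    have z0 : L (t, 0) (1, 0) = 0 := by
      have z1 : HasDerivWithinAt (fun s => Q s 0) 0 (Icc 0 b) t :=
        (hasDerivWithinAt_const t (Icc 0 b) (0 : ℝ)).congr
          (fun s hs => h.apply_zero (mem_timeInterval hbT hs))
          (h.apply_zero (mem_timeInterval hbT ht))
      exact (uniqueDiffOn_Icc hb t ht).eq_deriv _ (dt t ht 0 m0) z1
    rw [z0, h.apply_zero (mem_timeInterval hbT ht)] at e0
    linarith
  · intro x s y hx hs hxs hy hys
    have := intervalIntegral.integral_eq_sub_of_hasDerivAt_of_le (a := 0) (b := s)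
      (f := fun r => Q (clamp b (x + r)) (clamp 1 (y + r)))
      (f' := fun r => 1 / N (clamp b (x + r)) + K (Q (clamp b (x + r)) (clamp 1 (y + r)))) hs
      (cq.comp (f := fun r : ℝ => (x + r, y + r)) (by fun_prop)).continuousOn (fun r hr => ?_)
      (Continuous.intervalIntegrable ((ca.comp (f := fun r : ℝ => x + r) (by fun_prop)).add
        (hKc.comp (cq.comp (f := fun r : ℝ => (x + r, y + r)) (by fun_prop)))) _ _)
    · simpa using this.symm
    · have mx : x + r ∈ Ioo 0 b := ⟨by linarith [hr.1], by linarith [hr.2]⟩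
      have my : y + r ∈ Ioo 0 1 := ⟨by linarith [hr.1], by linarith [hr.2]⟩
      have mx' := Ioo_subset_Icc_self mx
      have my' := Ioo_subset_Icc_self my
      -- By linearity the left side of the equation is the total derivative in the characteristic
      -- direction `(1, 1)`.
      rw [clamp_of_mem mx', clamp_of_mem my', ← heq _ mx' _ my', ← map_add]
      have hd : HasDerivAt (fun r : ℝ => (x + r, y + r)) ((1 : ℝ), (1 : ℝ)) r :=
        ((hasDerivAt_id r).const_add x).prodMk ((hasDerivAt_id r).const_add y)
      have hQ := (dL (x + r, y + r) ⟨mx', my'⟩).hasFDerivAt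
        (prod_mem_nhds (Icc_mem_nhds mx.1 mx.2) (Icc_mem_nhds my.1 my.2))
      have hc := HasFDerivAt.comp_hasDerivAt (f := fun r : ℝ => (x + r, y + r)) r hQ hd
      simp only [Prod.mk_add_mk, add_zero, zero_add]
      refine hc.congr_of_eventuallyEq ?_
      have cx : ∀ᶠ u in 𝓝 r, x + u ∈ Ioo 0 b :=
        (continuous_const.add continuous_id).continuousAt.eventually (Ioo_mem_nhds mx.1 mx.2)
      have cy : ∀ᶠ u in 𝓝 r, y + u ∈ Ioo 0 1 :=
        (continuous_const.add continuous_id).continuousAt.eventually (Ioo_mem_nhds my.1 my.2)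
      filter_upwards [cx, cy] with u hu hu1
      rw [clamp_of_mem (Ioo_subset_Icc_self hu), clamp_of_mem (Ioo_subset_Icc_self hu1)]
      rfl

end IsClassicalSolution

/-! ### The two-sided estimate and the theorem -/

/-- The `L¹` estimate for two mild solutions. -/
theorem IsMildSolution.l1_bounds {K : ℝ → ℝ} {Φ b : ℝ} {q₁ p₁ q₂ p₂ : ℝ → ℝ → ℝ} {a₁ a₂ : ℝ → ℝ}
    (hΦ : 0 ≤ Φ) (hb : 0 ≤ b) (hK : ContDiff ℝ 2 K) (h₁ : IsMildSolution K Φ b q₁ p₁ a₁)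
    (h₂ : IsMildSolution K Φ b q₂ p₂ a₂) :
    Real.exp (kMin K Φ * b) * (∫ y in (0 : ℝ)..1, |p₁ 0 y - p₂ 0 y|) ≤
        ∫ y in (0 : ℝ)..1, |p₁ b y - p₂ b y| ∧
      (∫ y in (0 : ℝ)..1, |p₁ b y - p₂ b y|) ≤
        Real.exp (kMax K Φ * b) * ∫ y in (0 : ℝ)..1, |p₁ 0 y - p₂ 0 y| := by
  have hK1 : ContDiff ℝ 1 K := hK.of_le one_le_two
  have hk : ContDiff ℝ 1 (deriv K) := ((contDiff_succ_iff_deriv (n := 1)).1 hK).2.2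
  have ck := hk.continuous
  have sec : ∀ {f : ℝ → ℝ → ℝ} (t : ℝ), Continuous (Function.uncurry f) → Continuous (f t) :=
    fun t hf => hf.comp (Continuous.prodMk_right t)
  set d : ℝ → ℝ → ℝ := fun t y => p₁ t y - p₂ t y with hd
  set r : ℝ → ℝ → ℝ := fun t y => deriv K (q₁ t y) * p₁ t y - deriv K (q₂ t y) * p₂ t y with hr
  have cd : Continuous (Function.uncurry d) := h₁.continuous_p.sub h₂.continuous_p
  have cr₁ : Continuous (Function.uncurry fun t y => deriv K (q₁ t y) * p₁ t y) :=
    (ck.comp h₁.continuous_q).mul h₁.continuous_p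
  have cr₂ : Continuous (Function.uncurry fun t y => deriv K (q₂ t y) * p₂ t y) :=
    (ck.comp h₂.continuous_q).mul h₂.continuous_p
  have cr : Continuous (Function.uncurry r) := cr₁.sub cr₂
  have htr : ∀ x h y, 0 ≤ x → 0 ≤ h → h < 1 → x + h ≤ b → 0 ≤ y → y + h ≤ 1 →
      d (x + h) (y + h) = d x y + ∫ s in (0 : ℝ)..h, r (x + s) (y + s) := by
    intro x h y hx hh hh1 hxb hy hyh
    have cl : Continuous fun s : ℝ => (x + s, y + s) := by fun_prop
    have i₁ : Continuous fun s => deriv K (q₁ (x + s) (y + s)) * p₁ (x + s) (y + s) :=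
      cr₁.comp cl
    have i₂ : Continuous fun s => deriv K (q₂ (x + s) (y + s)) * p₂ (x + s) (y + s) :=
      cr₂.comp cl
    simp only [hd, hr]
    rw [intervalIntegral.integral_sub (i₁.intervalIntegrable _ _)
      (i₂.intervalIntegrable _ _), h₁.transport_deriv hK1 hx hh hh1 hxb hy hyh,
      h₂.transport_deriv hK1 hx hh hh1 hxb hy hyh]
    ring
  have hbd : ∀ x ∈ Icc 0 b, d x 0 = d x 1 := by
    intro x hx
    have e₁ := h₁.boundary x hx
    have e₂ := h₂.boundary x hx
    simp only [hd]
    linarith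
  have rate : ∀ k : ℝ → ℝ, ContDiff ℝ 1 k → ∀ t ∈ Icc 0 b,
      (∫ y in (0 : ℝ)..1, sgn (d t y) * (k (q₁ t y) * p₁ t y - k (q₂ t y) * p₂ t y)) ≤
      (k 0 + ∫ ψ in (0 : ℝ)..Φ, max (deriv k ψ) 0) * ∫ y in (0 : ℝ)..1, |d t y| :=
    fun k hk' t ht => production_le hΦ hk' (sec t h₁.continuous_p) (sec t h₂.continuous_p)
      (sec t h₁.continuous_q) (sec t h₂.continuous_q) (h₁.nonneg t) (h₂.nonneg t)
      (h₁.integral_p t ht) (h₂.integral_p t ht) (h₁.at_zero t ht) (h₂.at_zero t ht)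
      (h₁.at_one t ht) (h₂.at_one t ht) (measurable_sgn.comp (sec t cd).measurable)
      (fun _ => (abs_sgn _).le) fun _ => sgn_mul_self _
  refine ⟨l1_growth_lower hb cd cr htr hbd fun t ht => ?_,
    l1_growth hb cd cr htr hbd fun t ht => rate _ hk t ht⟩
  -- Since `max (-x) 0 = -min x 0`, the constant obtained for `-K'` is `-kMin K Φ`.
  have := rate (fun x => -deriv K x) hk.neg t ht
  have e1 : ∀ y, sgn (d t y) * (-deriv K (q₁ t y) * p₁ t y - -deriv K (q₂ t y) * p₂ t y) =
      -(sgn (d t y) * r t y) := fun y => by simp only [hr]; ring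
  have e2 : (-deriv K 0 + ∫ ψ in (0 : ℝ)..Φ, max (deriv (fun x => -deriv K x) ψ) 0) =
      -kMin K Φ := by
    have e3 : ∀ ψ, max (deriv (fun x => -deriv K x) ψ) 0 = -min (deriv (deriv K) ψ) 0 := by
      intro ψ
      rw [deriv.fun_neg, ← neg_zero, max_neg_neg, neg_zero]
    simp only [e3, intervalIntegral.integral_neg, kMin]
    ring
  simp only [e1, e2, intervalIntegral.integral_neg] at this
  linarith

lemma kMin_le_kMax {K : ℝ → ℝ} {Φ : ℝ} (hΦ : 0 ≤ Φ) (hK : ContDiff ℝ 2 K) :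
    kMin K Φ ≤ kMax K Φ := by
  have c : Continuous (deriv (deriv K)) :=
    (((contDiff_succ_iff_deriv (n := 1)).1 hK).2.2).continuous_deriv le_rfl
  unfold kMin kMax
  have := intervalIntegral.integral_mono_on (μ := volume) hΦ
    ((c.min continuous_const).intervalIntegrable 0 Φ)
    ((c.max continuous_const).intervalIntegrable 0 Φ) fun ψ _ =>
      (min_le_right _ _).trans (le_max_right (deriv (deriv K) ψ) 0)
  linarith

lemma IsClassicalSolution.contDiffOn_slice {K : ℝ → ℝ} {Φ : ℝ} {Qinit : ℝ → ℝ} {T : EReal}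
    {Q : ℝ → ℝ → ℝ} {N : ℝ → ℝ} (h : IsClassicalSolution K Φ Qinit T Q N) {t : ℝ}
    (ht : t ∈ timeInterval T) : ContDiffOn ℝ 1 (Q t) (Icc 0 1) :=
  h.contDiffOn.comp (f := fun y : ℝ => (t, y)) (contDiff_const.prodMk contDiff_id).contDiffOn
    fun _ hy => ⟨ht, hy⟩

lemma integrableOn_dEta_sub {f g : ℝ → ℝ} (hf : ContDiffOn ℝ 1 f (Icc 0 1))
    (hg : ContDiffOn ℝ 1 g (Icc 0 1)) :
    IntegrableOn (fun η => dEta f η - dEta g η) (Ioo (0 : ℝ) 1) := by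
  have hU : UniqueDiffOn ℝ (Icc (0 : ℝ) 1) := uniqueDiffOn_Icc zero_lt_one
  exact (((hf.continuousOn_derivWithin hU le_rfl).sub
    (hg.continuousOn_derivWithin hU le_rfl)).integrableOn_compact isCompact_Icc).mono_set
    Ioo_subset_Icc_self

lemma distBV_eq_integral_clamp (f g : ℝ → ℝ) :
    distBV f g = ∫ y in (0 : ℝ)..1, |dEta f (clamp 1 y) - dEta g (clamp 1 y)| := by
  rw [distBV, intervalIntegral.integral_of_le zero_le_one, integral_Ioc_eq_integral_Ioo]
  refine setIntegral_congr_fun measurableSet_Ioo fun y hy => ?_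
  simp only [clamp_of_mem (Ioo_subset_Icc_self hy)]

end PulseCoupled

open PulseCoupled in
theorem theorem4p1 (K : ℝ → ℝ) (Φ : ℝ) (hΦ : 0 < Φ) (hK : PulseCoupled.IsPhaseResponse K Φ)
    (Qinit₁ Qinit₂ : ℝ → ℝ) (T₁ T₂ : EReal)
    (Q₁ Q₂ : ℝ → ℝ → ℝ) (N₁ N₂ : ℝ → ℝ)
    (h₁ : PulseCoupled.IsClassicalSolution K Φ Qinit₁ T₁ Q₁ N₁)
    (h₂ : PulseCoupled.IsClassicalSolution K Φ Qinit₂ T₂ Q₂ N₂) :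
    PulseCoupled.kMin K Φ ≤ PulseCoupled.kMax K Φ ∧
    ∀ τ : ℝ, 0 ≤ τ → (τ : EReal) < T₁ → (τ : EReal) < T₂ →
      MeasureTheory.IntegrableOn
        (fun η => PulseCoupled.dEta (Q₁ 0) η - PulseCoupled.dEta (Q₂ 0) η)
        (Set.Ioo (0 : ℝ) 1) ∧
      MeasureTheory.IntegrableOn
        (fun η => PulseCoupled.dEta (Q₁ τ) η - PulseCoupled.dEta (Q₂ τ) η)
        (Set.Ioo (0 : ℝ) 1) ∧
      Real.exp (PulseCoupled.kMin K Φ * τ) * PulseCoupled.distBV (Q₁ 0) (Q₂ 0)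
        ≤ PulseCoupled.distBV (Q₁ τ) (Q₂ τ) ∧
      PulseCoupled.distBV (Q₁ τ) (Q₂ τ)
        ≤ Real.exp (PulseCoupled.kMax K Φ * τ) * PulseCoupled.distBV (Q₁ 0) (Q₂ 0) := by
  refine ⟨kMin_le_kMax hΦ.le hK.contDiff, fun τ hτ hτ₁ hτ₂ => ?_⟩
  refine ⟨integrableOn_dEta_sub (h₁.contDiffOn_slice ⟨le_rfl, h₁.T_pos⟩)
      (h₂.contDiffOn_slice ⟨le_rfl, h₂.T_pos⟩),
    integrableOn_dEta_sub (h₁.contDiffOn_slice ⟨hτ, hτ₁⟩) (h₂.contDiffOn_slice ⟨hτ, hτ₂⟩), ?_⟩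
  -- For `τ = 0` the rectangle degenerates, but both inequalities are equalities.
  rcases hτ.eq_or_lt with rfl | hpos
  · simp
  have key := (h₁.isMildSolution hK hpos hτ₁).l1_bounds hΦ.le hτ hK.contDiff
    (h₂.isMildSolution hK hpos hτ₂)
  have c0 : clamp τ 0 = 0 := clamp_of_mem ⟨le_rfl, hτ⟩
  have cτ : clamp τ τ = τ := clamp_of_mem ⟨hτ, le_rfl⟩
  simpa only [c0, cτ, ← distBV_eq_integral_clamp] using key
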